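/- Let $G$ be a countable discrete group acting by homeomorphisms on a compact metrizable space $M$ as a convergence group: for every sequence $(g_n)$ of distinct elements of $G$ there are a subsequence $(g_{n_k})$ and points $a,b\in M$ such that $g_{n_k}|_{M\setminus\{a\}}\to b$ locally uniformly, i.e. for every compact $K\subset M\setminus\{a\}$ and every neighbourhood $U$ of $b$ one has $g_{n_k}(K)\subset U$ for all large $k$. Assume that the action is non-elementary (no nonempty invariant subset of $M$ has at most two points) and minimal (no nonempty proper closed invariant subset). Let $\mu$ be a probability measure on $G$ whose support generates $G$ as a semigroup, and let $\nu$ be a $\mu$-stationary Borel probability measure on $M$, i.e. $\nu(A)=\sum_{g\in G}\mu(g)\,\nu(g^{-1}A)$ for every Borel set $A\subset M$. Let $g\in G$ fix two distinct points $a^-,a^+\in M$ and suppose that $g^n|_{M\setminus\{a^-\}}\to a^+$ locally uniformly as $n\to\infty$. Let $M_\infty^g$ be the set of points $p\in M$ for which there is a sequence $(g_n)$ of distinct elements of $G$ (depending on $p$) such that either $$g_np\to a^-\quad\text{and}\quad g_n|_{M\setminus\{p\}}\to a^+\ \text{locally uniformly},$$ or $$g_np\to a^+\quad\text{and}\quad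 g_n|_{M\setminus\{p\}}\to a^-\ \text{locally uniformly}.$$ Then $M_\infty^g$ is $\nu$-measurable (it belongs to the completion of the Borel $\sigma$-algebra with respect to $\nu$) and $\nu(M_\infty^g)=1$. -/

import Mathlib

open Filter Topology MeasureTheory

namespace ConvergenceGroup

variable {G M : Type*} [Group G] [TopologicalSpace M] [MulAction G M]

/-- The restrictions of `g n` to `M \ {a}` converge to the point `b` locally uniformly: for every
compact `K ⊆ M \ {a}` and every neighbourhood `U` of `b`, one has `g n • K ⊆ U` for all large `n`.
The point `a` is called repelling and `b` attracting for the sequence. -/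
def TendsToOff (g : ℕ → G) (a b : M) : Prop :=
  ∀ K : Set M, IsCompact K → a ∉ K → ∀ U ∈ 𝓝 b, ∀ᶠ n in atTop, ∀ x ∈ K, g n • x ∈ U

variable (G M) in
/-- `G` acts on `M` as a convergence group: every sequence of distinct elements has a subsequence
with a repelling point `a` and an attracting point `b` (possibly equal). -/
def IsConvergenceAction : Prop :=
  ∀ g : ℕ → G, Function.Injective g →
    ∃ φ : ℕ → ℕ, StrictMono φ ∧ ∃ a b : M, TendsToOff (g ∘ φ) a b

variable (G M) in
/-- The action is non-elementary: no nonempty invariant subset has at most two points. -/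
def IsNonElementary : Prop :=
  ∀ s : Set M, s.Nonempty → (∀ g : G, ∀ x ∈ s, g • x ∈ s) → 2 < s.encard

/-- `ν` is `μ`-stationary: `ν A = ∑ g, μ g * ν (g⁻¹ A)` for all measurable `A`. -/
def IsStationary [MeasurableSpace M] (μ : PMF G) (ν : Measure M) : Prop :=
  ∀ A : Set M, MeasurableSet A → ν A = ∑' g : G, μ g * ν ((fun x : M => g • x) ⁻¹' A)

variable (G) in
/-- There is a sequence of distinct elements of `G` which sends `p` towards `c` and whose
restrictions to `M \ {p}` converge to `b` locally uniformly. -/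
def HasConicalSequence (c b p : M) : Prop :=
  ∃ g : ℕ → G, Function.Injective g ∧ Tendsto (fun n => g n • p) atTop (𝓝 c) ∧ TendsToOff g p b

variable (G) in
/-- The points `p` admitting a sequence in `G` that carries `p` to one of the two points
`aminus`, `aplus` and all other points, locally uniformly, to the other one. -/
def conicalSet (aminus aplus : M) : Set M :=
  {p | HasConicalSequence G aminus aplus p ∨ HasConicalSequence G aplus aminus p}

end ConvergenceGroup

/-!
The points `p` for which some sequence of distinct elements of `G` sends `p` to `c` and everything
else to `b` have full measure for *every* pair `c ≠ b`; the element `g` is used only to see that `G`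
and `M` are infinite. The proof replaces the random walk and its boundary convergence by the
maximum principle on `G`.

For a measurable set `A`, the function `g ↦ ν (g⁻¹ A)` is `μ`-harmonic. By the maximum principle,
`ν` charges all nonempty open sets (`measure_pos_of_isOpen`) and has no atoms
(`measure_singleton_eq_zero`). Hence, along any sequence with attracting point `z`, the translates
of `ν` converge to the Dirac mass at `z`.

The key step (`measure_eq_zero_of_translates_le`) is a zero-one law: if `K` is compact and
`ν (g⁻¹ K) ≤ t < 1` for all but finitely many `g`, then `ν K = 0`. Indeed, let `V` be an open
neighbourhood of `K`. For all but finitely many `g`, the translate of `ν` is so concentrated that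
either it gives `K` almost no mass, or it gives `V`, hence `V \ K`, mass bounded below. So
`ν (g⁻¹ K) - 2 / (1 - t) * ν (g⁻¹ (V \ K))` is a harmonic function which is at most a small `η` off a
finite set, and by the maximum principle at most `η` at `g = 1`; now let `V` shrink to `K`.

Finally, the conical set contains a countable intersection of open sets `approxConicalSet G c b ε`.
If the complement `K` of one of these had positive measure, the zero-one law would give distinct
`g n` with `ν ((g n)⁻¹ K) → 1`, with repelling point `a` and attracting point `z`, say. Minimality
moves `a` close to `b` by some `s`, and since `(g n)⁻¹ K` meets every given open set for large `n`,
one finds points of `K` near `z` which `s (g n)⁻¹` moves close to `c`, while it contracts the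
complement of a neighbourhood of `z` towards `b`. Such points are in `approxConicalSet G c b ε`,
a contradiction.
-/

namespace ConvergenceGroup

/-! ### Harmonic functions on a group -/

theorem hasSum_toReal_pmf {α : Type*} (μ : PMF α) : HasSum (fun h => (μ h).toReal) 1 := by
  have h := ENNReal.hasSum_toReal (f := fun h => μ h) (by rw [μ.tsum_coe]; simp)
  rwa [← ENNReal.tsum_toReal_eq (fun h => μ.apply_ne_top h), μ.tsum_coe, ENNReal.toReal_one] at h

section Harmonic

variable {G : Type*} [Group G]

/-- `f` is `μ`-harmonic for the right random walk: `f g = ∑ h, μ h * f (g * h)`, where the series is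
required to converge. -/
def IsHarmonic (μ : PMF G) (f : G → ℝ) : Prop :=
  ∀ g, HasSum (fun h => (μ h).toReal * f (g * h)) (f g)

theorem IsHarmonic.sub_const_mul {μ : PMF G} {f f' : G → ℝ} (hf : IsHarmonic μ f)
    (hf' : IsHarmonic μ f') (c : ℝ) : IsHarmonic μ (fun g => f g - c * f' g) := by
  intro g
  have h := (hf g).sub ((hf' g).mul_left c)
  simpa only [mul_sub, mul_left_comm c] using h

theorem IsHarmonic.neg {μ : PMF G} {f : G → ℝ} (hf : IsHarmonic μ f) :
    IsHarmonic μ (fun g => -f g) := by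
  intro g
  simpa using (hf g).neg

/-- Maximum principle: a harmonic function which attains its maximum is constant. -/
theorem IsHarmonic.eq_of_forall_le {μ : PMF G} (hμ : Subsemigroup.closure μ.support = ⊤)
    {f : G → ℝ} (hf : IsHarmonic μ f) {g₀ : G} (hmax : ∀ g, f g ≤ f g₀) (g : G) :
    f g = f g₀ := by
  have step : ∀ h ∈ μ.support, ∀ k, f k = f g₀ → f (k * h) = f g₀ := by
    intro h hh k hk
    have hs : HasSum (fun h => (μ h).toReal * (f g₀ - f (k * h))) 0 := by
      have h1 := ((hasSum_toReal_pmf μ).mul_right (f g₀)).sub (hf k)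
      rw [hk, one_mul, sub_self] at h1
      simpa only [mul_sub] using h1
    have h0 := (hasSum_zero_iff_of_nonneg (fun h =>
      mul_nonneg ENNReal.toReal_nonneg (sub_nonneg.2 (hmax _)))).1 hs
    have h1 := congrFun h0 h
    have hpos : (μ h).toReal ≠ 0 :=
      ENNReal.toReal_ne_zero.2 ⟨(μ.mem_support_iff h).1 hh, μ.apply_ne_top h⟩
    simp only [Pi.zero_apply, mul_eq_zero, hpos, false_or] at h1
    linarith
  have all : ∀ x : G, ∀ k, f k = f g₀ → f (k * x) = f g₀ := by
    intro x
    have hx : x ∈ Subsemigroup.closure μ.support := by rw [hμ]; trivial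
    induction hx using Subsemigroup.closure_induction with
    | mem x hx => exact step x hx
    | mul x y _ _ ihx ihy =>
      intro k hk
      rw [← mul_assoc]
      exact ihy _ (ihx k hk)
  simpa using all (g₀⁻¹ * g) g₀ rfl

/-- A harmonic function on an infinite group which is at most `η` off a finite set is at most `η`
everywhere. -/
theorem IsHarmonic.le_of_finite_setOf_lt [Infinite G] {μ : PMF G}
    (hμ : Subsemigroup.closure μ.support = ⊤) {f : G → ℝ} (hf : IsHarmonic μ f) {η : ℝ}
    (hfin : {g | η < f g}.Finite) (g : G) : f g ≤ η := by
  by_contra! hlt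
  obtain ⟨g₀, hg₀, hmax⟩ := hfin.exists_maximalFor f _ ⟨g, hlt⟩
  have hle : ∀ k, f k ≤ f g₀ := by
    intro k
    by_cases hk : η < f k
    · by_contra! h
      exact absurd (hmax hk h.le) (not_le.2 h)
    · exact (not_lt.1 hk).trans (le_of_lt hg₀)
  have hconst := hf.eq_of_forall_le hμ hle
  refine Set.infinite_univ (hfin.subset fun k _ => ?_)
  simpa only [Set.mem_ofPred_eq, hconst k] using hg₀

end Harmonic

/-! ### Stationary measures -/

section Stationary

variable {G M : Type*} [Group G] [MulAction G M]

/-- The mass that the translate of `ν` by `g` gives to `A`, namely `ν (g⁻¹ A)`. -/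
noncomputable def translateMass [MeasurableSpace M] (ν : Measure M) (A : Set M) (g : G) : ℝ :=
  ν.real ((fun x : M => g • x) ⁻¹' A)

theorem translateMass_one [MeasurableSpace M] (ν : Measure M) (A : Set M) :
    translateMass (G := G) ν A 1 = ν.real A := by
  simp [translateMass]

variable [TopologicalSpace M] [MeasurableSpace M] [BorelSpace M] [ContinuousConstSMul G M]
  {μ : PMF G} {ν : Measure M} [IsProbabilityMeasure ν]

theorem measurableSet_preimage_smul (g : G) {A : Set M} (hA : MeasurableSet A) :
    MeasurableSet ((fun x : M => g • x) ⁻¹' A) :=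
  (continuous_const_smul g).measurable hA

theorem IsStationary.isHarmonic_translateMass (hν : IsStationary μ ν) {A : Set M}
    (hA : MeasurableSet A) : IsHarmonic μ (translateMass ν A) := by
  intro g
  have key := hν _ (measurableSet_preimage_smul g hA)
  have h := ENNReal.hasSum_toReal (key ▸ measure_ne_top ν _)
  rw [← ENNReal.tsum_toReal_eq
    (fun h => ENNReal.mul_ne_top (μ.apply_ne_top h) (measure_ne_top _ _)), ← key] at h
  simpa only [translateMass, Measure.real, ENNReal.toReal_mul, Set.preimage_preimage, mul_smul]
    using h

/-- A stationary measure of a minimal action charges every nonempty open set. -/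
theorem measure_pos_of_isOpen [Countable G] [MulAction.IsMinimal G M]
    (hμ : Subsemigroup.closure μ.support = ⊤) (hν : IsStationary μ ν) {U : Set M}
    (hU : IsOpen U) (hU' : U.Nonempty) : 0 < ν.real U := by
  by_contra! h
  have h1 : translateMass (G := G) ν U 1 ≤ 0 := by rwa [translateMass_one]
  have hconst := (hν.isHarmonic_translateMass hU.measurableSet).neg.eq_of_forall_le hμ (g₀ := 1)
    (fun g => neg_le_neg (h1.trans measureReal_nonneg))
  have hzero : ∀ g : G, ν ((fun x : M => g • x) ⁻¹' U) = 0 := by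
    intro g
    have h2 : translateMass ν U g = 0 :=
      le_antisymm ((neg_inj.1 (hconst g)).le.trans h1) measureReal_nonneg
    exact (measureReal_eq_zero_iff (measure_ne_top _ _)).1 h2
  have hcover : (⋃ g : G, (fun x : M => g • x) ⁻¹' U) = Set.univ :=
    hU.iUnion_preimage_smul G hU'
  have := measure_iUnion_null hzero
  simp [hcover] at this

/-- A stationary measure of a minimal action on an infinite space has no atoms: by the maximum
principle all points in the orbit of an atom are atoms of the same mass, so the orbit, which is
dense, would be finite. -/
theorem measure_singleton_eq_zero [T1Space M] [Infinite M] [MulAction.IsMinimal G M]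
    (hμ : Subsemigroup.closure μ.support = ⊤) (hν : IsStationary μ ν) (y : M) : ν {y} = 0 := by
  by_contra hy
  have hfin : {z : M | ν {y} ≤ ν {z}}.Finite :=
    Measure.finite_const_le_meas_of_disjoint_iUnion ν (pos_iff_ne_zero.2 hy)
      (fun z => measurableSet_singleton z)
      (fun a b hab => Set.disjoint_singleton.2 hab) (measure_ne_top _ _)
  have hpre : ∀ g : G, translateMass ν {y} g = ν.real {g⁻¹ • y} := by
    intro g
    unfold translateMass
    congr 1
    ext x
    simp [eq_inv_smul_iff]
  obtain ⟨z, ⟨hz, hzy⟩, hmax⟩ := (hfin.inter_of_left (MulAction.orbit G y)).exists_maximalFor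
    (fun z => ν {z}) _ ⟨y, le_refl (ν {y}), MulAction.mem_orbit_self y⟩
  obtain ⟨k, rfl⟩ := hzy
  have hle : ∀ g : G, translateMass ν {y} g ≤ translateMass ν {y} k⁻¹ := by
    intro g
    rw [hpre, hpre, inv_inv]
    refine ENNReal.toReal_mono (measure_ne_top _ _) ?_
    by_contra! hlt
    exact absurd (hmax ⟨hz.trans hlt.le, MulAction.mem_orbit _ _⟩ hlt.le) (not_le.2 hlt)
  have hconst := (hν.isHarmonic_translateMass (measurableSet_singleton y)).eq_of_forall_le hμ hle
  have horb : (MulAction.orbit G y).Finite := by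
    refine hfin.subset ?_
    rintro _ ⟨g, rfl⟩
    have h := hconst g⁻¹
    rw [hpre, hpre, inv_inv, inv_inv] at h
    have h' : ν {g • y} = ν {k • y} :=
      (ENNReal.toReal_eq_toReal_iff' (measure_ne_top _ _) (measure_ne_top _ _)).1 h
    simpa only [Set.mem_ofPred_eq, h'] using hz
  have huniv := horb.isClosed.closure_eq ▸ (MulAction.dense_orbit G y).closure_eq
  exact Set.infinite_univ (huniv ▸ horb)

end Stationary

/-! ### The zero-one law -/

/-- A decreasing sequence of infinite sets admits an injective choice function. -/
theorem exists_injective_forall_mem {α : Type*} {S : ℕ → Set α} (hS : Antitone S)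
    (hinf : ∀ n, (S n).Infinite) : ∃ f : ℕ → α, Function.Injective f ∧ ∀ n, f n ∈ S n := by
  classical
  -- The pairs carry their level, so that the `n`-th one has level at least `n`.
  obtain ⟨f, hf, hlt⟩ := exists_seq_of_forall_finset_exists
    (fun p : ℕ × α => p.2 ∈ S p.1) (fun p q => p.1 < q.1 ∧ p.2 ≠ q.2) (by
      intro s _
      obtain ⟨x, hx, hxs⟩ := (hinf (s.sup Prod.fst + 1)).exists_notMem_finset (s.image Prod.snd)
      refine ⟨(s.sup Prod.fst + 1, x), hx, fun p hp => ⟨?_, ?_⟩⟩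
      · exact Nat.lt_succ_of_le (Finset.le_sup (f := Prod.fst) hp)
      · rintro rfl
        exact hxs (Finset.mem_image_of_mem _ hp))
  have hmono : StrictMono fun n => (f n).1 := fun m n hmn => (hlt m n hmn).1
  refine ⟨fun n => (f n).2, ?_, fun n => hS (hmono.id_le n) (hf n)⟩
  intro m n hmn
  rcases lt_trichotomy m n with h | h | h
  · exact absurd hmn (hlt m n h).2
  · exact h
  · exact absurd hmn.symm (hlt n m h).2

section ZeroOne

variable {G M : Type*} [Group G] [MulAction G M] [TopologicalSpace M] [CompactSpace M]
  [TopologicalSpace.MetrizableSpace M] [MeasurableSpace M] [BorelSpace M]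
  [ContinuousConstSMul G M] {μ : PMF G} {ν : Measure M} [IsProbabilityMeasure ν]

/-- If `ν` has no atoms, its translates accumulate only at Dirac masses, so that all but finitely
many of them give a closed set almost no mass or a given neighbourhood of it almost full mass. -/
theorem finite_setOf_lt_translateMass (hconv : IsConvergenceAction G M)
    (hatom : ∀ y : M, ν {y} = 0) {K V : Set M} (hK : IsClosed K) (hV : IsOpen V) (hKV : K ⊆ V)
    {η : ℝ} (hη : 0 < η) :
    {g : G | η < translateMass ν K g ∧ translateMass ν V g < 1 - η}.Finite := by
  by_contra hinf
  obtain ⟨f, hfinj, hf⟩ := exists_injective_forall_mem (antitone_const) fun _ : ℕ => hinf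
  obtain ⟨φ, -, a, b, hab⟩ := hconv f hfinj
  obtain ⟨C, hCa, hC, hCη⟩ := (measurableSet_singleton a).compl.exists_isCompact_lt_add
    (measure_ne_top ν _) (ENNReal.ofReal_pos.2 hη).ne'
  have hCη' : 1 - η < ν.real C := by
    rw [prob_compl_eq_one_sub (measurableSet_singleton a), hatom, tsub_zero] at hCη
    have h := ENNReal.toReal_strict_mono
      (ENNReal.add_ne_top.2 ⟨measure_ne_top ν C, ENNReal.ofReal_ne_top⟩) hCη
    rw [ENNReal.toReal_add (measure_ne_top _ _) ENNReal.ofReal_ne_top, ENNReal.toReal_one,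
      ENNReal.toReal_ofReal hη.le] at h
    change 1 < ν.real C + η at h
    linarith
  have haC : a ∉ C := fun h => hCa h rfl
  by_cases hb : b ∈ V
  · obtain ⟨n, hn⟩ := (hab C hC haC V (hV.mem_nhds hb)).exists
    have h := measureReal_mono (μ := ν) (show C ⊆ (fun x => f (φ n) • x) ⁻¹' V from hn)
    exact absurd (hCη'.trans_le h) (not_lt.2 (hf (φ n)).2.le)
  · obtain ⟨n, hn⟩ := (hab C hC haC Kᶜ (hK.isOpen_compl.mem_nhds fun h => hb (hKV h))).exists
    have h := measureReal_mono (μ := ν) (show C ⊆ ((fun x => f (φ n) • x) ⁻¹' K)ᶜ from hn)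
    rw [probReal_compl_eq_one_sub (measurableSet_preimage_smul _ hK.measurableSet)] at h
    have h' := (hf (φ n)).1
    unfold translateMass at h'
    linarith

/-- Zero-one law, in contrapositive form: if a closed set has positive measure for a stationary
measure without atoms, then infinitely many translates of the measure give it mass close to one. -/
theorem measure_eq_zero_of_translates_le [Infinite G] (hconv : IsConvergenceAction G M)
    (hμ : Subsemigroup.closure μ.support = ⊤) (hν : IsStationary μ ν)
    (hatom : ∀ y : M, ν {y} = 0) {K : Set M} (hK : IsClosed K) {t : ℝ} (ht : t < 1)
    (hfin : {g : G | t < translateMass ν K g}.Finite) : ν K = 0 := by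
  rw [← measureReal_eq_zero_iff]
  refine le_antisymm (le_of_forall_pos_le_add fun ε hε => ?_) measureReal_nonneg
  rw [zero_add]
  obtain ⟨η, hη, hηε, hηt⟩ : ∃ η : ℝ, 0 < η ∧ η ≤ ε / 2 ∧ η ≤ (1 - t) / 2 :=
    ⟨min (ε / 2) ((1 - t) / 2), lt_min (by linarith) (by linarith), min_le_left _ _,
      min_le_right _ _⟩
  -- This bound on `ν (V \ K)` makes `2 / (1 - t) * ν (V \ K)` at most `ε / 2`.
  have hδ : 0 < ε * (1 - t) / 4 := by have := sub_pos.2 ht; positivity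
  obtain ⟨V, hKV, hV, hVK⟩ := K.exists_isOpen_lt_add (measure_ne_top ν K)
    (ENNReal.ofReal_pos.2 hδ).ne'
  have hdiff : ν.real (V \ K) ≤ ε * (1 - t) / 4 := by
    have h := ENNReal.toReal_mono
      (ENNReal.add_ne_top.2 ⟨measure_ne_top ν K, ENNReal.ofReal_ne_top⟩) hVK.le
    rw [ENNReal.toReal_add (measure_ne_top _ _) ENNReal.ofReal_ne_top,
      ENNReal.toReal_ofReal hδ.le] at h
    change ν.real V ≤ ν.real K + _ at h
    rw [measureReal_sdiff hKV hK.measurableSet]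
    linarith
  have hharm := (hν.isHarmonic_translateMass hK.measurableSet).sub_const_mul
    (hν.isHarmonic_translateMass (hV.measurableSet.diff hK.measurableSet)) (2 / (1 - t))
  have hbad : {g : G | η < translateMass ν K g -
      2 / (1 - t) * translateMass ν (V \ K) g}.Finite := by
    refine (hfin.union (finite_setOf_lt_translateMass hconv hatom hK hV hKV hη)).subset ?_
    intro g hg
    by_contra hg'
    simp only [Set.mem_union, Set.mem_ofPred_eq, not_or, not_lt, not_and] at hg hg'
    have hnn : 0 ≤ translateMass ν (V \ K) g := measureReal_nonneg
    have hc : 0 < 2 / (1 - t) := div_pos two_pos (sub_pos.2 ht)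
    have hVg := hg'.2 (by nlinarith)
    have hsub : translateMass ν (V \ K) g = translateMass ν V g - translateMass ν K g := by
      unfold translateMass
      rw [Set.preimage_sdiff, measureReal_sdiff (Set.preimage_mono hKV)
        (measurableSet_preimage_smul g hK.measurableSet)]
    have hlow : (1 - t) / 2 ≤ translateMass ν (V \ K) g := by
      rw [hsub]; linarith [hg'.1]
    have hone : 1 ≤ 2 / (1 - t) * translateMass ν (V \ K) g := by
      have h := mul_le_mul_of_nonneg_left hlow hc.le
      have h1 : 2 / (1 - t) * ((1 - t) / 2) = 1 := by
        field_simp [(sub_pos.2 ht).ne']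
      linarith
    linarith [hg'.1]
  have hle := hharm.le_of_finite_setOf_lt hμ hbad 1
  rw [translateMass_one, translateMass_one] at hle
  have h2 : 2 / (1 - t) * ν.real (V \ K) ≤ ε / 2 := by
    rw [div_mul_eq_mul_div, div_le_iff₀ (sub_pos.2 ht)]
    linarith
  linarith

end ZeroOne

/-! ### Conical sequences -/

/-- The points `p` for which some `h : G` sends `p` into the `ε`-ball around `c` and the complement
of some `ε`-ball containing `p` into the `ε`-ball around `b`. The centre `z` of that ball is a
parameter of its own, which makes the set open by its very form. -/
def approxConicalSet (G : Type*) {M : Type*} [Group G] [MetricSpace M] [MulAction G M]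
    (c b : M) (ε : ℝ) : Set M :=
  {p | ∃ (h : G) (z : M), dist p z < ε ∧ dist (h • p) c < ε ∧
    ∀ y, ε ≤ dist y z → dist (h • y) b < ε}

section Conical

variable {G M : Type*} [Group G] [MetricSpace M] [MulAction G M]

theorem isOpen_approxConicalSet [ContinuousConstSMul G M] (c b : M) (ε : ℝ) :
    IsOpen (approxConicalSet G c b ε) := by
  simp only [approxConicalSet, Set.ofPred_exists, Set.ofPred_and]
  refine isOpen_iUnion fun h => isOpen_iUnion fun z => ?_
  refine (isOpen_lt (continuous_id.dist continuous_const) continuous_const).inter ?_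
  refine (isOpen_lt ((continuous_const_smul h).dist continuous_const) continuous_const).inter ?_
  exact isOpen_const

/-- A point which is approximately conical at the scales `1 / (n + 1)` is conical. The elements that
realise the scales can be taken distinct, since a single element which works at all scales would
collapse the infinite set `M \ {p}` to a point. -/
theorem hasConicalSequence_of_forall_mem [Infinite M] {c b p : M}
    (hp : ∀ n : ℕ, p ∈ approxConicalSet G c b (1 / ((n : ℝ) + 1))) : HasConicalSequence G c b p := by
  let S : ℕ → Set G := fun n => {h | ∃ z, dist p z < 1 / ((n : ℝ) + 1) ∧
    dist (h • p) c < 1 / ((n : ℝ) + 1) ∧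
    ∀ y, 1 / ((n : ℝ) + 1) ≤ dist y z → dist (h • y) b < 1 / ((n : ℝ) + 1)}
  have hanti : Antitone S := by
    rintro m n hmn h ⟨z, h1, h2, h3⟩
    have hle : 1 / ((n : ℝ) + 1) ≤ 1 / ((m : ℝ) + 1) := Nat.one_div_le_one_div hmn
    exact ⟨z, h1.trans_le hle, h2.trans_le hle, fun y hy => (h3 y (hle.trans hy)).trans_le hle⟩
  have hlim := tendsto_one_div_add_atTop_nhds_zero_nat (𝕜 := ℝ)
  -- Off `p`, the conditions of `S n` amount to convergence to `b`.
  have hconv : ∀ f : ℕ → G, (∀ n, f n ∈ S n) → TendsToOff f p b := by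
    intro f hf K hK hpK U hU
    obtain ⟨ρ, hρ, hρU⟩ := Metric.mem_nhds_iff.1 hU
    obtain ⟨r, hr, hrK⟩ := Metric.mem_nhds_iff.1 (hK.isClosed.isOpen_compl.mem_nhds hpK)
    filter_upwards [hlim.eventually (gt_mem_nhds hρ), hlim.eventually (gt_mem_nhds (half_pos hr))]
      with n hnρ hnr x hx
    obtain ⟨z, h1, -, h3⟩ := hf n
    have hxr : r ≤ dist x p := by
      by_contra! h
      exact hrK (Metric.mem_ball.2 h) hx
    refine hρU (Metric.mem_ball.2 ((h3 x ?_).trans hnρ))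
    linarith [dist_triangle x z p, dist_comm p z]
  have hinf : ∀ n, (S n).Infinite := by
    intro n hfin
    have hempty : ∀ h : G, ∃ m, h ∉ S m := by
      intro h
      by_contra! hall
      have hto := hconv (fun _ => h) hall
      have hcollapse : ∀ y, y ≠ p → h • y = b := by
        intro y hy
        by_contra hyb
        obtain ⟨_, hm⟩ := (hto {y} isCompact_singleton (fun h => hy h.symm) {h • y}ᶜ
          (isOpen_compl_singleton.mem_nhds (Ne.symm hyb))).exists
        exact hm y rfl rfl
      refine Set.infinite_univ (((Set.finite_singleton (h⁻¹ • b)).insert p).subset fun y _ => ?_)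
      by_cases hy : y = p
      · exact Or.inl hy
      · exact Or.inr (eq_inv_smul_iff.2 (hcollapse y hy))
    choose m hm using hempty
    let N := max n (hfin.toFinset.sup m)
    obtain ⟨h, hh⟩ : (S N).Nonempty := hp N
    have hhn : h ∈ S n := hanti (le_max_left _ _) hh
    exact hm h (hanti ((Finset.le_sup (hfin.mem_toFinset.2 hhn)).trans (le_max_right _ _)) hh)
  obtain ⟨f, hfinj, hf⟩ := exists_injective_forall_mem hanti hinf
  refine ⟨f, hfinj, ?_, hconv f hf⟩
  rw [tendsto_iff_dist_tendsto_zero]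
  exact squeeze_zero (fun _ => dist_nonneg) (fun n => (hf n).choose_spec.2.1.le) hlim

/-- A stationary measure of a minimal convergence action gives full measure to the approximately
conical points for any two distinct targets. -/
theorem measure_compl_approxConicalSet [Countable G] [Infinite G] [Infinite M] [CompactSpace M]
    [MeasurableSpace M] [BorelSpace M] [ContinuousConstSMul G M] [MulAction.IsMinimal G M]
    (hconv : IsConvergenceAction G M) {μ : PMF G} (hμ : Subsemigroup.closure μ.support = ⊤)
    {ν : Measure M} [IsProbabilityMeasure ν] (hν : IsStationary μ ν) {c b : M} (hcb : c ≠ b)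
    {ε : ℝ} (hε : 0 < ε) : ν (approxConicalSet G c b ε)ᶜ = 0 := by
  by_contra hpos
  set K := (approxConicalSet G c b ε)ᶜ with hKdef
  have hK : IsClosed K := (isOpen_approxConicalSet c b ε).isClosed_compl
  obtain ⟨f, hfinj, hf⟩ := exists_injective_forall_mem
    (S := fun n : ℕ => {g : G | 1 - 1 / ((n : ℝ) + 1) < translateMass ν K g})
    (fun m n hmn g hg => lt_of_le_of_lt
      (sub_le_sub_left (Nat.one_div_le_one_div (α := ℝ) hmn) 1) hg)
    (fun n hfin => hpos (measure_eq_zero_of_translates_le hconv hμ hν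
      (measure_singleton_eq_zero hμ hν) hK (sub_lt_self _ (by positivity)) hfin))
  obtain ⟨φ, hφ, a, z, haz⟩ := hconv f hfinj
  -- With this radius, the balls around `c` and `b` are disjoint.
  obtain ⟨r, hr, hrε, hrcb⟩ : ∃ r : ℝ, 0 < r ∧ r ≤ ε ∧ r ≤ dist c b / 2 :=
    ⟨min ε (dist c b / 2), lt_min hε (half_pos (dist_pos.2 hcb)), min_le_left _ _,
      min_le_right _ _⟩
  obtain ⟨s, hs⟩ := Metric.isOpen_ball.exists_smul_mem G a ⟨b, Metric.mem_ball_self (x := b) hr⟩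
  set O := (fun x : M => s • x) ⁻¹' Metric.ball c r with hO
  set W := (fun x : M => s • x) ⁻¹' Metric.ball b r with hW
  have hWopen : IsOpen W := Metric.isOpen_ball.preimage (continuous_const_smul s)
  have hOopen : IsOpen O := Metric.isOpen_ball.preimage (continuous_const_smul s)
  have hOpos : 0 < ν.real O := measure_pos_of_isOpen hμ hν hOopen
    ⟨s⁻¹ • c, by simpa [hO] using hr⟩
  have hlim := (tendsto_one_div_add_atTop_nhds_zero_nat (𝕜 := ℝ)).comp hφ.tendsto_atTop
  obtain ⟨n, hnW, hnO⟩ := ((haz Wᶜ hWopen.isClosed_compl.isCompact (fun h => h hs) _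
    (Metric.ball_mem_nhds z hε)).and (hlim.eventually (gt_mem_nhds hOpos))).exists
  have hmass := hf (φ n)
  simp only [Function.comp_apply] at hnW hnO
  generalize f (φ n) = g at hnW hmass
  -- `O` and `g⁻¹ K` meet, since their masses add up to more than one.
  obtain ⟨x, hxO, hxK⟩ : ∃ x ∈ O, g • x ∈ K := by
    by_contra! hdisj
    have h := measureReal_mono (μ := ν) (show O ⊆ ((fun x => g • x) ⁻¹' K)ᶜ from hdisj)
    rw [probReal_compl_eq_one_sub (measurableSet_preimage_smul _ hK.measurableSet)] at h
    simp only [Set.mem_ofPred_eq, translateMass] at hmass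
    linarith
  refine hxK ⟨s * g⁻¹, z, hnW x fun hxW => ?_, ?_, fun y hy => ?_⟩
  · have h1 : dist (s • x) c < r := hxO
    have h2 : dist (s • x) b < r := hxW
    linarith [dist_triangle_left c b (s • x)]
  · rw [mul_smul, inv_smul_smul]
    exact lt_of_lt_of_le hxO hrε
  · have hyW : g⁻¹ • y ∈ W := by
      by_contra h
      have h1 := hnW _ h
      rw [smul_inv_smul] at h1
      exact absurd hy (not_le.2 h1)
    rw [mul_smul]
    exact lt_of_lt_of_le hyW hrε

end Conical

/-! ### Infinitude from a loxodromic element -/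

section Loxodromic

variable {G M : Type*} [Group G] [TopologicalSpace M] [T1Space M] [MulAction G M]

/-- A point other than `aminus` and `aplus` has an infinite orbit under the powers of `g`. -/
theorem injective_pow_smul_of_tendsToOff {g : G} {aminus aplus x : M}
    (hg : TendsToOff (fun n : ℕ => g ^ n) aminus aplus)
    (hxm : x ≠ aminus) (hxp : x ≠ aplus) : Function.Injective fun n : ℕ => g ^ n • x := by
  -- If `x` were periodic, it would return infinitely often, and so it would be `aplus`.
  have hper : ∀ k : ℕ, 0 < k → g ^ k • x ≠ x := by
    intro k hk hkx
    obtain ⟨N, hN⟩ := eventually_atTop.1 (hg {x} isCompact_singleton (fun h => hxm h.symm) {x}ᶜ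
      (isOpen_compl_singleton.mem_nhds hxp.symm))
    have hret : ∀ j : ℕ, (g ^ k) ^ j • x = x := fun j => by
      induction j with
      | zero => simp
      | succ j ih => rw [pow_succ, mul_smul, hkx, ih]
    refine hN (k * N) (Nat.le_mul_of_pos_left N hk) x rfl ?_
    simpa only [pow_mul, Set.mem_singleton_iff] using hret N
  have hlt : ∀ m n : ℕ, m < n → g ^ m • x ≠ g ^ n • x := by
    intro m n hmn h
    refine hper (n - m) (Nat.sub_pos_of_lt hmn) ?_
    have h1 : g ^ n = g ^ m * g ^ (n - m) := by rw [← pow_add]; congr 1; omega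
    rw [h1, mul_smul] at h
    exact (smul_left_cancel _ h).symm
  intro m n hmn
  rcases lt_trichotomy m n with h | h | h
  · exact absurd hmn (hlt m n h)
  · exact h
  · exact absurd hmn.symm (hlt n m h)

end Loxodromic

end ConvergenceGroup

open ConvergenceGroup in
theorem mainTheorem5 {G M : Type*} [Group G] [Countable G]
    [TopologicalSpace M] [CompactSpace M] [TopologicalSpace.MetrizableSpace M]
    [MeasurableSpace M] [BorelSpace M]
    [MulAction G M] [ContinuousConstSMul G M] [MulAction.IsMinimal G M]
    (hconv : ConvergenceGroup.IsConvergenceAction G M)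
    (hne : ConvergenceGroup.IsNonElementary G M)
    (μ : PMF G) (hμ : Subsemigroup.closure μ.support = ⊤)
    (ν : Measure M) [IsProbabilityMeasure ν] (hν : ConvergenceGroup.IsStationary μ ν)
    (g : G) (aminus aplus : M) (hne' : aminus ≠ aplus)
    (hminus : g • aminus = aminus) (hplus : g • aplus = aplus)
    (hg : ConvergenceGroup.TendsToOff (fun n : ℕ => g ^ n) aminus aplus) :
    NullMeasurableSet (ConvergenceGroup.conicalSet G aminus aplus) ν ∧
      ν (ConvergenceGroup.conicalSet G aminus aplus) = 1 := by
  let := TopologicalSpace.metrizableSpaceMetric M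
  obtain ⟨x, -, hx⟩ : ∃ x ∈ (Set.univ : Set M), x ∉ ({aminus, aplus} : Set M) := by
    by_contra! h
    have h2 : (Set.univ : Set M).encard ≤ 2 :=
      (Set.encard_le_encard fun y hy => h y hy).trans (Set.encard_pair hne').le
    exact absurd (hne Set.univ ⟨aplus, trivial⟩ fun _ _ _ => trivial) (not_lt.2 h2)
  simp only [Set.mem_insert_iff, Set.mem_singleton_iff, not_or] at hx
  have hinj := injective_pow_smul_of_tendsToOff hg hx.1 hx.2
  have : Infinite M := Infinite.of_injective _ hinj
  have : Infinite G := Infinite.of_injective (fun n : ℕ => g ^ n)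
    fun m n h => hinj (congrArg (· • x) h)
  have hnull : ν (conicalSet G aminus aplus)ᶜ = 0 := by
    refine measure_mono_null (t := ⋃ n : ℕ,
      (approxConicalSet G aminus aplus (1 / ((n : ℝ) + 1)))ᶜ) ?_
      (measure_iUnion_null fun n =>
        measure_compl_approxConicalSet hconv hμ hν hne' (by positivity))
    intro p hp
    by_contra hp'
    simp only [Set.mem_iUnion, Set.mem_compl_iff, not_exists, not_not] at hp'
    exact hp (Or.inl (hasConicalSequence_of_forall_mem hp'))
  exact ⟨(NullMeasurableSet.of_null hnull).of_compl, (prob_compl_eq_zero_iff₀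
    (NullMeasurableSet.of_null hnull).of_compl).1 hnull⟩
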